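/- Notation. $I=[0,1]$. Thompson's group $F$ is the group of orientation-preserving homeomorphisms of $I$ that are piecewise affine with finitely many breakpoints, all dyadic rationals, and with all slopes integral powers of $2$. An orbital of a homeomorphism $f$ of $I$ is a maximal interval contained in $\{t : f(t)\neq t\}$; the bump of $f$ on an orbital $A$ is the homeomorphism equal to $f$ on $A$ and to the identity off $A$. For $t\in I$ put $t'=1-t$. The groups $W_C$. Remove from $[0,1]$ the open middle half, and repeat on each remaining closed interval. Let $M$ be the set of midpoints of those deleted intervals that lie in $[3/4,1]$; for $x\in M$ let $r_x<x$ be the left endpoint of the deleted interval containing $x$. For a countable totally ordered set $C$ choose an order embedding $C\to M$, with image $B$, and for each $x\in B$ an element $f_x\in F$ with $f_x(r_x')=r_x$, with $f_x(t)=t$ for $t\in[0,x']\cup[x,1]$, and with $f_x(t)\ne t$ for $t\in(x',x)$. Let $W_C$ be the subgroup of $F$ generated by all $f_x$, $x \in B$. For a finite subset $X=\{x_1<\dots<x_n\}$ of $B$ let $G_X=\langle f_{x_1},\dots,f_{x_n}\rangle$; the functions $g_p=f_{x_p}$, with nested orbitals $(x_p',x_p)$, are the signatures of its generating tower. An element $h\in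 G_X$ has level $m$ in $G_X$ if it is represented by a word $w$ in $g_1,\dots,g_n$ such that $m$ is the greatest $p$ for which the sum of the exponents of the occurrences of $g_p$ in $w$ is nonzero. Statement. Let $C,D$ be countable totally ordered sets and let $W_C$, $W_D$ be groups so constructed. Let $X_1\subseteq X_2\subseteq\cdots$ be finite sets exhausting the index set of the generators of $W_C$, let $Y_1\subseteq Y_2\subseteq\cdots$ be finite sets exhausting that of $W_D$, and let $G_i=G_{X_i}\le W_C$ and $H_i=G_{Y_i}\le W_D$, so that the inclusions $G_1\le G_2\le\cdots$ and $H_1\le H_2\le\cdots$ are direct systems for $W_C$ and $W_D$. Let $P$ be an inj-isomorphism between them, that is, homomorphisms $d_i:G_i\to H_i$ and $u_i:H_i\to G_{i+1}$ such that $u_i d_i$ is the inclusion $G_i\le G_{i+1}$ and $d_{i+1}u_i$ is the inclusion $H_i\le H_{i+1}$, for all $i$. Then for every $i$: (1) for every signature $g$ of the generating tower of $G_i$, every bump of $d_i(g)$ is an element of $H_i$ which has a unique level in $H_i$, and all bumps of $d_i(g)$ have the same level in $H_i$; (2) for every signature $h$ of the generating tower of $H_i$, every bump of $u_i(h)$ is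 an element of $G_{i+1}$ which has a unique level in $G_{i+1}$, and all bumps of $u_i(h)$ have the same level in $G_{i+1}$. -/

import Mathlib

namespace WC

/-- The group of homeomorphisms of the unit interval, under composition. -/
abbrev HomeoI : Type := unitInterval ≃ₜ unitInterval

/-- Dyadic rationals, as real numbers. -/
def IsDyadic (x : ℝ) : Prop := ∃ (m : ℤ) (n : ℕ), x = m / 2 ^ n

/-- Membership in Thompson's group `F`: an orientation-preserving homeomorphism of the unit
interval for which there is a finite set of dyadic rationals such that the map is affine with
slope an integral power of `2` on every closed interval whose interior misses that set. -/
def IsThompsonF (f : HomeoI) : Prop :=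
  StrictMono f ∧
    ∃ S : Finset ℝ, (∀ s ∈ S, IsDyadic s) ∧
      ∀ a b : unitInterval, a < b → (∀ s ∈ S, s ∉ Set.Ioo (a : ℝ) b) →
        ∃ k : ℤ, ∀ t ∈ Set.Icc a b, (f t : ℝ) = f a + (2 : ℝ) ^ k * ((t : ℝ) - a)

/-- The support of a homeomorphism. -/
def supp (f : HomeoI) : Set unitInterval := {t | f t ≠ t}

/-- An orbital of `f`: a maximal (nonempty) interval contained in the support of `f`. -/
def IsOrbital (f : HomeoI) (A : Set unitInterval) : Prop :=
  Maximal (fun S : Set unitInterval => S.Nonempty ∧ S.OrdConnected ∧ S ⊆ supp f) A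

/-- `b` is the bump of `f` on `A`, regarded as a homeomorphism of the unit interval:
it agrees with `f` on the orbital `A` of `f`, and it is the identity elsewhere. -/
def IsBumpOn (f : HomeoI) (A : Set unitInterval) (b : HomeoI) : Prop :=
  IsOrbital f A ∧ (∀ t ∈ A, b t = f t) ∧ ∀ t ∉ A, b t = t

/-! ### The construction of the groups `W_C` -/

/-- The closed intervals `[a, b]` that occur at some stage of the Cantor-type construction in
`[0, 1]` that removes the open middle half of each interval at each stage. -/
inductive IsStageInterval : ℝ → ℝ → Prop
  | unit : IsStageInterval 0 1
  | left {a b : ℝ} : IsStageInterval a b → IsStageInterval a (a + (b - a) / 4)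
  | right {a b : ℝ} : IsStageInterval a b → IsStageInterval (b - (b - a) / 4) b

/-- `(l, r)` is one of the open intervals removed in that construction. -/
def IsDeletedInterval (l r : ℝ) : Prop :=
  ∃ a b : ℝ, IsStageInterval a b ∧ l = a + (b - a) / 4 ∧ r = b - (b - a) / 4

/-- The choices made in the construction of a group `W_C`: an order embedding of `C` into the set
of midpoints of the deleted intervals confined to `[3/4, 1]`, and for each `c` an element `f c` of
Thompson's group whose support is `(x', x)`, where `x` is the chosen midpoint, and which takes `l'`
to `l`, where `l` is the left endpoint of the deleted interval around `x`; here `t' = 1 - t`. -/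
structure Construction (C : Type*) [LinearOrder C] where
  /-- left endpoint of the deleted interval attached to `c` -/
  left : C → ℝ
  /-- right endpoint of the deleted interval attached to `c` -/
  right : C → ℝ
  deleted : ∀ c, IsDeletedInterval (left c) (right c)
  confined : ∀ c, Set.Ioo (left c) (right c) ⊆ Set.Icc (3 / 4) 1
  strictMono_mid : StrictMono fun c => (left c + right c) / 2
  /-- the generators -/
  f : C → HomeoI
  mem_F : ∀ c, IsThompsonF (f c)
  map_left : ∀ (c : C) (t : unitInterval), (t : ℝ) = 1 - left c → (f c t : ℝ) = left c
  supp_eq : ∀ (c : C) (t : unitInterval),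
    t ∈ supp (f c) ↔ (t : ℝ) ∈ Set.Ioo (1 - (left c + right c) / 2) ((left c + right c) / 2)

namespace Construction

variable {C : Type*} [LinearOrder C]

/-- The group `W_C`. -/
def group (W : Construction C) : Subgroup HomeoI := Subgroup.closure (Set.range W.f)

/-- The signatures of the generating tower attached to a finite subset `X` of `C`, listed in
increasing order (of the points of `X`, equivalently of their orbitals). -/
def gen (W : Construction C) (X : Finset C) (p : Fin X.card) : HomeoI :=
  W.f (X.orderEmbOfFin rfl p)

/-- The subgroup of `W_C` generated by the signatures attached to the points of `X`. -/
def subgroup (W : Construction C) (X : Finset C) : Subgroup HomeoI :=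
  Subgroup.closure (Set.range (W.gen X))

/-- A signature of the generating tower, as an element of the subgroup it helps to generate. -/
def genMem (W : Construction C) (X : Finset C) (p : Fin X.card) : W.subgroup X :=
  ⟨W.gen X p, Subgroup.subset_closure ⟨p, rfl⟩⟩

end Construction

/-! ### Direct systems and inj-isomorphisms -/

/-- An increasing sequence of finite subsets with union `C`. It gives the direct system
`W.subgroup (X 0) ≤ W.subgroup (X 1) ≤ ⋯` for `W_C`, whose bonding maps are the inclusions. -/
structure IsExhaustion {C : Type*} (X : ℕ → Finset C) : Prop where
  mono : Monotone X
  exhausts : ∀ c, ∃ i, c ∈ X i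

/-- An inj-isomorphism between two increasing sequences of subgroups (bonding maps are
inclusions): homomorphisms `d i : G i → H i` and `u i : H i → G (i + 1)` for which all triangles
commute, i.e. `u i ∘ d i` and `d (i + 1) ∘ u i` are the inclusions. -/
structure InjIso {Γ : Type*} [Group Γ] (G H : ℕ → Subgroup Γ) where
  d : ∀ i, G i →* H i
  u : ∀ i, H i →* G (i + 1)
  u_d : ∀ (i : ℕ) (g : G i), (u i (d i g) : Γ) = g
  d_u : ∀ (i : ℕ) (h : H i), (d (i + 1) (u i h) : Γ) = h

/-! ### Levels -/

/-- The algebraic sum of the word `w` with respect to the `p`-th generator: the sum of the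
exponents of the occurrences of that generator in `w`. -/
def algSum {n : ℕ} (p : Fin n) (w : FreeGroup (Fin n)) : ℤ :=
  (FreeGroup.lift (fun q : Fin n => Multiplicative.ofAdd (if q = p then (1 : ℤ) else 0)) w).toAdd

/-- With respect to the ordered generators `g 0, …, g (n - 1)` (which have levels `1, …, n`),
the element `h` has level `m`: it is represented by a word `w` for which `m` is the greatest
level of a generator with nonzero algebraic sum. -/
def HasLevel {Γ : Type*} [Group Γ] {n : ℕ} (g : Fin n → Γ) (h : Γ) (m : ℕ) : Prop :=
  ∃ w : FreeGroup (Fin n), FreeGroup.lift g w = h ∧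
    IsGreatest {k : ℕ | ∃ p : Fin n, k = (p : ℕ) + 1 ∧ algSum p w ≠ 0} m

end WC

namespace WC

open Set Filter Topology unitInterval

/-! The group generated by a tower is an iterated wreath product with ℤ. The translates of the
fundamental domain of the last generator `T.top` tile its support, and all earlier generators live
inside that domain. A word therefore shifts the tiles by its exponent sum in the last letter, and
acts in tile `j` by a lower word `κ j`, trivial for almost all `j` (`exists_isCoords`). Peeling off
one generator at a time shows that exponent sums depend only on the group element, so levels are
unique; it also shows that every orbital is a translate of some generator's support, its bump being
a group element with that generator's level (`exists_bump`).

Equality of levels comes from an algebraic property of an element `h` of a group: whenever `t ^ k *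
h * (t ^ k)⁻¹` commutes with `h` for all large `k`, so does `t * h * t⁻¹`. Generators of a tower
have it (`commute_conj_of_eventually`). An element with orbitals of two different levels does not
(`exists_eventually_commute_not_commute`): the smaller orbital, with its fixed endpoint, lies in a
translate of the support that carries the larger one, and a `t` moving one translate to the other is
a counterexample.

The property passes to the image `h` of a generator `g`: `u` sends `h` back to `g`, which is still a
generator of the larger group, and `d'` carries the resulting commutation back to `h`. -/

/-! ### Iteration of increasing homeomorphisms -/

theorem homeo_inv_apply_self (f : HomeoI) (x : I) : f⁻¹ (f x) = x := f.symm_apply_apply x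

theorem homeo_apply_inv_self (f : HomeoI) (x : I) : f (f⁻¹ x) = x := f.apply_symm_apply x

theorem homeo_inv_apply_eq_iff (f : HomeoI) {x y : I} : f⁻¹ x = y ↔ x = f y := f.symm_apply_eq

theorem homeo_zpow_add_apply (f : HomeoI) (i j : ℤ) (x : I) :
    (f ^ (i + j)) x = (f ^ i) ((f ^ j) x) := by
  rw [zpow_add, Homeomorph.mul_apply]

theorem homeo_inv_fix {f : HomeoI} {x : I} (h : f x = x) : f⁻¹ x = x :=
  (homeo_inv_apply_eq_iff f).2 h.symm

/-- The subgroup of strictly increasing homeomorphisms. -/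
def monoHomeo : Subgroup HomeoI where
  carrier := {f | StrictMono f}
  mul_mem' {f g} hf hg := fun _ _ h => hf (hg h)
  one_mem' := fun _ _ h => h
  inv_mem' {f} hf := fun x y h => by
    rw [← hf.lt_iff_lt, homeo_apply_inv_self, homeo_apply_inv_self]
    exact h

theorem homeo_zpow_fix {f : HomeoI} {x : I} (h : f x = x) (k : ℤ) : (f ^ k) x = x := by
  induction k using Int.induction_on with
  | zero => simp
  | succ n ih => rw [homeo_zpow_add_apply, zpow_one, h, ih]
  | pred n ih =>
    rw [sub_eq_add_neg, homeo_zpow_add_apply, zpow_neg_one, homeo_inv_fix h, ih]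

theorem homeo_pow_succ_apply (f : HomeoI) (k : ℕ) (x : I) : (f ^ (k + 1)) x = f ((f ^ k) x) := by
  rw [pow_succ', Homeomorph.mul_apply]

theorem fixed_of_tendsto {f : HomeoI} {x y : I}
    (h : Tendsto (fun k : ℕ => (f ^ k) x) atTop (𝓝 y)) : f y = y := by
  have h1 : Tendsto (fun k : ℕ => (f ^ (k + 1)) x) atTop (𝓝 y) := h.comp (tendsto_add_atTop_nat 1)
  have h2 : Tendsto (fun k : ℕ => f ((f ^ k) x)) atTop (𝓝 (f y)) :=
    (f.continuous.tendsto y).comp h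
  simp_rw [homeo_pow_succ_apply] at h1
  exact tendsto_nhds_unique h2 h1

/-- Otherwise the increasing orbit of `x` converges to a fixed point in `[x, t]`. -/
theorem exists_lt_pow_apply {f : HomeoI} (hf : StrictMono f) {x t : I} (hx : x < f x)
    (h : ∀ y, x ≤ y → y ≤ t → f y ≠ y) : ∃ k : ℕ, t < (f ^ k) x := by
  by_contra! hc
  have hm : Monotone fun k : ℕ => (f ^ k) x := by
    refine monotone_nat_of_le_succ fun k => ?_
    have hk : StrictMono (f ^ k : HomeoI) := pow_mem (show f ∈ monoHomeo from hf) k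
    rw [pow_succ, Homeomorph.mul_apply]
    exact (hk hx).le
  have ht := tendsto_atTop_ciSup hm (OrderTop.bddAbove _)
  refine h _ ?_ (ciSup_le hc) (fixed_of_tendsto ht)
  exact le_ciSup_of_le (OrderTop.bddAbove _) 0 (by simp)

theorem exists_pow_apply_lt {f : HomeoI} (hf : StrictMono f) {x t : I} (hx : f x < x)
    (h : ∀ y, y ≤ x → t ≤ y → f y ≠ y) : ∃ k : ℕ, (f ^ k) x < t := by
  by_contra! hc
  have hm : Antitone fun k : ℕ => (f ^ k) x := by
    refine antitone_nat_of_succ_le fun k => ?_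
    have hk : StrictMono (f ^ k : HomeoI) := pow_mem (show f ∈ monoHomeo from hf) k
    rw [pow_succ, Homeomorph.mul_apply]
    exact (hk hx).le
  have ht := tendsto_atTop_ciInf hm (OrderBot.bddBelow _)
  refine h _ ?_ (le_ciInf hc) (fixed_of_tendsto ht)
  exact ciInf_le_of_le (OrderBot.bddBelow _) 0 (by simp)

/-- If `f` has no fixed point in the `f`-invariant interval `(α, β)`, and `h` commutes with `f` and
is the identity near the right end of `(α, β)`, then `h` is the identity on `(α, β)`. -/
theorem fixed_of_commute_of_fixed_near_end {f h : HomeoI} (hf : StrictMono f) {α β e : I}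
    (hβ : f β = β) (hfix : ∀ t ∈ Ioo α β, f t ≠ t) (he : e < β)
    (hh : ∀ t ∈ Ioo e β, h t = t) (hc : Commute f h) : ∀ t ∈ Ioo α β, h t = t := by
  have key : ∀ f : HomeoI, StrictMono f → f β = β → (∀ t ∈ Ioo α β, f t ≠ t) → Commute f h →
      ∀ t ∈ Ioo α β, t < f t → h t = t := by
    intro f hf hβ hfix hc t ht htf
    -- An iterate of `f` pushes `t` past `e`, where `h` is trivial; commutation brings this back to
    -- `t`.
    obtain ⟨k, hk⟩ := exists_lt_pow_apply hf (t := max e t) htf fun y hy hy' =>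
      hfix y ⟨ht.1.trans_le hy, hy'.trans_lt (max_lt he ht.2)⟩
    have hmono : StrictMono (f ^ k : HomeoI) := pow_mem (show f ∈ monoHomeo from hf) k
    have hkβ : (f ^ k) β = β := by exact_mod_cast homeo_zpow_fix hβ k
    have h1 : h ((f ^ k) t) = (f ^ k) t :=
      hh _ ⟨(le_max_left _ _).trans_lt hk, by simpa only [hkβ] using hmono ht.2⟩
    have h2 : (f ^ k) (h t) = h ((f ^ k) t) := by
      rw [← Homeomorph.mul_apply, (hc.pow_left k).eq, Homeomorph.mul_apply]
    exact hmono.injective (h2.trans h1)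
  intro t ht
  rcases lt_or_gt_of_ne (hfix t ht) with h1 | h1
  · have hf' : StrictMono (f⁻¹ : HomeoI) := inv_mem (show f ∈ monoHomeo from hf)
    refine key f⁻¹ hf' (homeo_inv_fix hβ) (fun t ht h => hfix t ht ?_) hc.inv_left t ht ?_
    · exact ((homeo_inv_apply_eq_iff f).1 h).symm
    · rw [← hf.lt_iff_lt, homeo_apply_inv_self]
      exact h1
  · exact key f hf hβ hfix hc t ht h1

/-! ### Translations and their fundamental domains -/

/-- `s` is increasing with support `(a, b)`, and `[lo, hi)` is a fundamental domain for its action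
on `(a, b)`. -/
structure IsTranslation (s : HomeoI) (a lo hi b : I) : Prop where
  mono : StrictMono s
  supp_iff : ∀ t, s t ≠ t ↔ t ∈ Ioo a b
  map_lo : s lo = hi
  lo_lt_hi : lo < hi
  a_lt_lo : a < lo
  hi_lt_b : hi < b

namespace IsTranslation

variable {s : HomeoI} {a lo hi b : I}

theorem zpow_mono (hs : IsTranslation s a lo hi b) (k : ℤ) : StrictMono (s ^ k : HomeoI) :=
  zpow_mem (show s ∈ monoHomeo from hs.mono) k

theorem zpow_lo_strictMono (hs : IsTranslation s a lo hi b) :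
    StrictMono fun k : ℤ => (s ^ k) lo := by
  refine strictMono_int_of_lt_succ fun k => ?_
  rw [homeo_zpow_add_apply, zpow_one, hs.map_lo]
  exact hs.zpow_mono k hs.lo_lt_hi

theorem zpow_hi (hs : IsTranslation s a lo hi b) (k : ℤ) : (s ^ k) hi = (s ^ (k + 1)) lo := by
  rw [homeo_zpow_add_apply, zpow_one, hs.map_lo]

theorem zpow_apply_unique (hs : IsTranslation s a lo hi b) {i j : ℤ} {x y : I}
    (hx : x ∈ Ico lo hi) (hy : y ∈ Ico lo hi) (h : (s ^ i) x = (s ^ j) y) : i = j := by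
  have key : ∀ {i j : ℤ} {x y : I}, x ∈ Ico lo hi → y ∈ Ico lo hi → (s ^ i) x = (s ^ j) y →
      i ≤ j := by
    intro i j x y hx hy h
    by_contra! hij
    have h1 : (s ^ (j + 1)) lo ≤ (s ^ i) lo := hs.zpow_lo_strictMono.monotone hij
    rw [← hs.zpow_hi] at h1
    have h2 := (hs.zpow_mono i).monotone hx.1
    have h3 := hs.zpow_mono j hy.2
    exact absurd ((h1.trans h2).trans_eq h) h3.not_ge
  exact le_antisymm (key hx hy h) (key hy hx h.symm)

theorem exists_zpow_apply (hs : IsTranslation s a lo hi b) {t : I} (ht : t ∈ Ioo a b) :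
    ∃ j : ℤ, ∃ x ∈ Ico lo hi, (s ^ j) x = t := by
  obtain ⟨k, hk⟩ : ∃ k : ℕ, t < (s ^ k) lo :=
    exists_lt_pow_apply hs.mono (by rw [hs.map_lo]; exact hs.lo_lt_hi) fun y hy hy' =>
      (hs.supp_iff y).2 ⟨hs.a_lt_lo.trans_le hy, hy'.trans_lt ht.2⟩
  have hinv : StrictMono (s⁻¹ : HomeoI) := inv_mem (show s ∈ monoHomeo from hs.mono)
  obtain ⟨l, hl⟩ : ∃ l : ℕ, (s⁻¹ ^ l) lo < t := by
    refine exists_pow_apply_lt hinv ?_ fun y hy hy' h => ?_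
    · rw [← hs.mono.lt_iff_lt, homeo_apply_inv_self, hs.map_lo]
      exact hs.lo_lt_hi
    · refine (hs.supp_iff y).2 ⟨ht.1.trans_le hy', hy.trans_lt (hs.lo_lt_hi.trans hs.hi_lt_b)⟩ ?_
      exact ((homeo_inv_apply_eq_iff s).1 h).symm
  have hl' : (s ^ (-l : ℤ)) lo ≤ t := by
    rw [zpow_neg, ← inv_zpow, zpow_natCast]
    exact hl.le
  -- The tile containing `t` is the last one whose left end does not exceed `t`.
  obtain ⟨j, hj, hmax⟩ := Int.exists_greatest_of_bdd (P := fun j => (s ^ j) lo ≤ t)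
    ⟨k, fun z hz => (hs.zpow_lo_strictMono.lt_iff_lt.1 (hz.trans_lt (by exact_mod_cast hk))).le⟩
    ⟨_, hl'⟩
  refine ⟨j, (s ^ (-j)) t, ⟨?_, ?_⟩, ?_⟩
  · rw [← (hs.zpow_mono j).le_iff_le, ← homeo_zpow_add_apply]
    simpa using hj
  · rw [← (hs.zpow_mono j).lt_iff_lt, ← homeo_zpow_add_apply, hs.zpow_hi]
    by_contra! hc
    have := hmax (j + 1) (by simpa using hc)
    omega
  · rw [← homeo_zpow_add_apply]
    simp

theorem fix_a (hs : IsTranslation s a lo hi b) : s a = a :=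
  not_not.1 fun h => lt_irrefl _ ((hs.supp_iff a).1 h).1

theorem fix_b (hs : IsTranslation s a lo hi b) : s b = b :=
  not_not.1 fun h => lt_irrefl _ ((hs.supp_iff b).1 h).2

theorem zpow_apply_mem (hs : IsTranslation s a lo hi b) {x : I} (hx : x ∈ Ioo a b) (k : ℤ) :
    (s ^ k) x ∈ Ioo a b := by
  have h1 := hs.zpow_mono k hx.1
  have h2 := hs.zpow_mono k hx.2
  rw [homeo_zpow_fix hs.fix_a] at h1
  rw [homeo_zpow_fix hs.fix_b] at h2
  exact ⟨h1, h2⟩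

end IsTranslation

/-! ### Exponent sums -/

theorem algSum_mul {n : ℕ} (p : Fin n) (v w : FreeGroup (Fin n)) :
    algSum p (v * w) = algSum p v + algSum p w := by
  simp [algSum]

theorem algSum_one {n : ℕ} (p : Fin n) : algSum p 1 = 0 := by
  simp [algSum]

theorem algSum_inv {n : ℕ} (p : Fin n) (w : FreeGroup (Fin n)) :
    algSum p w⁻¹ = - algSum p w := by
  simp [algSum]

theorem algSum_of {n : ℕ} (p q : Fin n) : algSum p (FreeGroup.of q) = if q = p then 1 else 0 := by
  simp [algSum]

theorem algSum_conj {n : ℕ} (p : Fin n) (c v : FreeGroup (Fin n)) :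
    algSum p (c * v * c⁻¹) = algSum p v := by
  simp [algSum_mul, algSum_inv]

theorem algSum_map_castSucc {n : ℕ} (p : Fin n) (w : FreeGroup (Fin n)) :
    algSum p.castSucc (FreeGroup.map Fin.castSucc w) = algSum p w := by
  induction w using FreeGroup.induction_on with
  | C1 => simp [algSum_one]
  | of x => simp [algSum_of]
  | inv_of x _ => simp [algSum_of, algSum_inv]
  | mul x y hx hy => rw [map_mul, algSum_mul, algSum_mul, hx, hy]

theorem algSum_last_map_castSucc {n : ℕ} (w : FreeGroup (Fin n)) :
    algSum (Fin.last n) (FreeGroup.map Fin.castSucc w) = 0 := by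
  induction w using FreeGroup.induction_on with
  | C1 => simp [algSum_one]
  | of x => simp [algSum_of, Fin.castSucc_ne_last]
  | inv_of x _ => simp [algSum_of, algSum_inv, Fin.castSucc_ne_last]
  | mul x y hx hy => rw [map_mul, algSum_mul, hx, hy, add_zero]

/-! ### Towers and their words -/

/-- A tower of homeomorphisms of the unit interval: the support of `g p` is the interval
`(a p, b p)`, and the closure of the support of each earlier generator is contained in the
fundamental domain `[lo p, hi p)` of `g p`. -/
structure Tower (n : ℕ) where
  /-- the generators -/
  g : Fin n → HomeoI
  /-- left ends of the supports -/
  a : Fin n → I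
  /-- left ends of the fundamental domains -/
  lo : Fin n → I
  /-- right ends of the fundamental domains -/
  hi : Fin n → I
  /-- right ends of the supports -/
  b : Fin n → I
  translation : ∀ p, IsTranslation (g p) (a p) (lo p) (hi p) (b p)
  nested : ∀ p q, p < q → lo q < a p ∧ b p < hi q

namespace Tower

/-- The homeomorphism represented by a word in the generators. -/
def eval {n : ℕ} (T : Tower n) : FreeGroup (Fin n) →* HomeoI := FreeGroup.lift T.g

/-- The tower without its last generator. -/
def init {n : ℕ} (T : Tower (n + 1)) : Tower n where
  g p := T.g p.castSucc
  a p := T.a p.castSucc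
  lo p := T.lo p.castSucc
  hi p := T.hi p.castSucc
  b p := T.b p.castSucc
  translation p := T.translation p.castSucc
  nested _ _ h := T.nested _ _ (Fin.castSucc_lt_castSucc_iff.2 h)

/-- The last generator. -/
def top {n : ℕ} (T : Tower (n + 1)) : HomeoI := T.g (Fin.last n)

/-- The support of the `p`-th generator. -/
def orb {n : ℕ} (T : Tower n) (p : Fin n) : Set I := Ioo (T.a p) (T.b p)

/-- The fundamental domain of the last generator. -/
def dom {n : ℕ} (T : Tower (n + 1)) : Set I := Ico (T.lo (Fin.last n)) (T.hi (Fin.last n))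

theorem eval_of {n : ℕ} (T : Tower n) (p : Fin n) : T.eval (FreeGroup.of p) = T.g p := by
  simp [eval]

theorem eval_mono {n : ℕ} (T : Tower n) (w : FreeGroup (Fin n)) : StrictMono (T.eval w) := by
  change T.eval w ∈ monoHomeo
  induction w using FreeGroup.induction_on with
  | C1 => rw [map_one]; exact one_mem _
  | of x => rw [eval_of]; exact (T.translation x).mono
  | inv_of x h => rw [map_inv]; exact inv_mem h
  | mul x y hx hy => rw [map_mul]; exact mul_mem hx hy

theorem eval_fix {n : ℕ} (T : Tower n) {t : I} (h : ∀ p, t ∉ T.orb p) (w : FreeGroup (Fin n)) :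
    T.eval w t = t := by
  induction w using FreeGroup.induction_on with
  | C1 => rw [map_one]; rfl
  | of x => rw [eval_of]; exact not_not.1 fun hx => h x (((T.translation x).supp_iff t).1 hx)
  | inv_of x h => rw [map_inv]; exact homeo_inv_fix h
  | mul x y hx hy => rw [map_mul, Homeomorph.mul_apply, hy, hx]

theorem eval_map_castSucc {n : ℕ} (T : Tower (n + 1)) (w : FreeGroup (Fin n)) :
    T.eval (FreeGroup.map Fin.castSucc w) = T.init.eval w := by
  induction w using FreeGroup.induction_on with
  | C1 => simp
  | of x => simp only [FreeGroup.map.of, eval_of]; rfl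
  | inv_of x h => rw [map_inv, map_inv, map_inv, h]
  | mul x y hx hy => rw [map_mul, map_mul, map_mul, hx, hy]

theorem topTranslation {n : ℕ} (T : Tower (n + 1)) : IsTranslation T.top (T.a (Fin.last n))
    (T.lo (Fin.last n)) (T.hi (Fin.last n)) (T.b (Fin.last n)) :=
  T.translation _

theorem orb_init_subset {n : ℕ} (T : Tower (n + 1)) (p : Fin n) :
    Icc (T.init.a p) (T.init.b p) ⊆ Ioo (T.lo (Fin.last n)) (T.hi (Fin.last n)) := fun _ ht =>
  have h := T.nested p.castSucc (Fin.last n) (Fin.castSucc_lt_last p)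
  ⟨h.1.trans_le ht.1, ht.2.trans_lt h.2⟩

theorem dom_subset {n : ℕ} (T : Tower (n + 1)) : T.dom ⊆ T.orb (Fin.last n) := fun _ ht =>
  ⟨T.topTranslation.a_lt_lo.trans_le ht.1, ht.2.trans T.topTranslation.hi_lt_b⟩

theorem init_eval_fix {n : ℕ} (T : Tower (n + 1)) {t : I}
    (ht : t ∉ Ioo (T.lo (Fin.last n)) (T.hi (Fin.last n))) (w : FreeGroup (Fin n)) :
    T.init.eval w t = t :=
  T.init.eval_fix (fun p hp => ht (T.orb_init_subset p (Ioo_subset_Icc_self hp))) w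

theorem init_eval_mem_Ioo {n : ℕ} (T : Tower (n + 1)) {t : I}
    (ht : t ∈ Ioo (T.lo (Fin.last n)) (T.hi (Fin.last n))) (w : FreeGroup (Fin n)) :
    T.init.eval w t ∈ Ioo (T.lo (Fin.last n)) (T.hi (Fin.last n)) := by
  have h1 := T.init.eval_mono w ht.1
  have h2 := T.init.eval_mono w ht.2
  rw [T.init_eval_fix (fun h => lt_irrefl _ h.1)] at h1
  rw [T.init_eval_fix (fun h => lt_irrefl _ h.2)] at h2
  exact ⟨h1, h2⟩

theorem init_eval_mem_dom {n : ℕ} (T : Tower (n + 1)) {t : I} (ht : t ∈ T.dom)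
    (w : FreeGroup (Fin n)) : T.init.eval w t ∈ T.dom := by
  have h1 := (T.init.eval_mono w).monotone ht.1
  have h2 := T.init.eval_mono w ht.2
  rw [T.init_eval_fix (fun h => lt_irrefl _ h.1)] at h1
  rw [T.init_eval_fix (fun h => lt_irrefl _ h.2)] at h2
  exact ⟨h1, h2⟩

theorem eval_fix_of_notMem {n : ℕ} (T : Tower (n + 1)) {t : I} (ht : t ∉ T.orb (Fin.last n))
    (w : FreeGroup (Fin (n + 1))) : T.eval w t = t := by
  refine T.eval_fix (fun p hp => ?_) w
  induction p using Fin.lastCases with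
  | last => exact ht hp
  | cast p =>
    exact ht (T.dom_subset (Ioo_subset_Ico_self (T.orb_init_subset p (Ioo_subset_Icc_self hp))))

/-! ### Wreath product coordinates -/

/-- `κ` is the family of coordinates of the word `w` in the wreath product of the group of words in
the first `n` generators with the infinite cyclic group generated by the last one. -/
structure IsCoords {n : ℕ} (T : Tower (n + 1)) (w : FreeGroup (Fin (n + 1)))
    (κ : ℤ → FreeGroup (Fin n)) : Prop where
  apply : ∀ j, ∀ t ∈ T.dom, T.eval w ((T.top ^ j) t) =
    (T.top ^ (j + algSum (Fin.last n) w)) (T.init.eval (κ j) t)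
  finite : {j | κ j ≠ 1}.Finite
  algSum_castSucc : ∀ p : Fin n, algSum p.castSucc w = ∑ᶠ j, algSum p (κ j)

theorem finite_algSum {n : ℕ} {κ : ℤ → FreeGroup (Fin n)} (h : {j | κ j ≠ 1}.Finite) (p : Fin n) :
    (Function.support fun j => algSum p (κ j)).Finite :=
  h.subset fun j hj h1 => hj (by simp only [h1, algSum_one])

theorem isCoords_one {n : ℕ} (T : Tower (n + 1)) : T.IsCoords 1 fun _ => 1 where
  apply j t _ := by simp [algSum_one]
  finite := by simp
  algSum_castSucc p := by simp [algSum_one]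

theorem isCoords_of_last {n : ℕ} (T : Tower (n + 1)) :
    T.IsCoords (FreeGroup.of (Fin.last n)) fun _ => 1 where
  apply j t _ := by
    rw [eval_of, algSum_of, if_pos rfl, add_comm j, homeo_zpow_add_apply, zpow_one, map_one]
    rfl
  finite := by simp
  algSum_castSucc p := by simp [algSum_one, algSum_of, (Fin.castSucc_ne_last p).symm]

theorem isCoords_of_castSucc {n : ℕ} (T : Tower (n + 1)) (q : Fin n) :
    T.IsCoords (FreeGroup.of q.castSucc) (Pi.mulSingle 0 (FreeGroup.of q)) where
  apply j t ht := by
    rw [eval_of, algSum_of, if_neg (Fin.castSucc_ne_last q), add_zero]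
    by_cases hj : j = 0
    · subst hj
      rw [Pi.mulSingle_eq_same, eval_of, zpow_zero]
      rfl
    · rw [Pi.mulSingle_eq_of_ne hj, map_one]
      change (T.g q.castSucc) _ = (T.top ^ j) t
      by_contra hne
      have h1 := ((T.translation q.castSucc).supp_iff _).1 hne
      have h2 := Ioo_subset_Ico_self (T.orb_init_subset q (Ioo_subset_Icc_self h1))
      -- The support of a lower generator lies in tile `0`, so it meets no tile `j ≠ 0`.
      exact hj (T.topTranslation.zpow_apply_unique ht h2 (by rw [zpow_zero]; rfl))
  finite := (Set.finite_singleton 0).subset fun j hj => by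
    by_contra h
    exact hj (Pi.mulSingle_eq_of_ne h _)
  algSum_castSucc p := by
    rw [finsum_eq_single _ 0 fun j hj => by rw [Pi.mulSingle_eq_of_ne hj, algSum_one]]
    simp [algSum_of]

theorem IsCoords.inv {n : ℕ} {T : Tower (n + 1)} {w : FreeGroup (Fin (n + 1))}
    {κ : ℤ → FreeGroup (Fin n)} (h : T.IsCoords w κ) :
    T.IsCoords w⁻¹ fun j => (κ (j - algSum (Fin.last n) w))⁻¹ where
  apply j t ht := by
    rw [map_inv, homeo_inv_apply_eq_iff, algSum_inv, ← sub_eq_add_neg,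
      h.apply _ _ (T.init_eval_mem_dom ht _), sub_add_cancel, map_inv, homeo_apply_inv_self]
  finite := by
    refine (h.finite.preimage (sub_left_injective (b := algSum (Fin.last n) w)).injOn).subset ?_
    intro j hj
    simpa using hj
  algSum_castSucc p := by
    simp only [algSum_inv, h.algSum_castSucc]
    rw [finsum_neg_distrib]
    congr 1
    exact (finsum_comp_equiv (Equiv.subRight (algSum (Fin.last n) w))
      (f := fun j => algSum p (κ j))).symm

/-- `w` acts first and moves tile `j` by its top exponent sum, so the coordinate of `v` is read at
the shifted index. The shift does not change the total exponent sums. -/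
theorem IsCoords.mul {n : ℕ} {T : Tower (n + 1)} {v w : FreeGroup (Fin (n + 1))}
    {κ ξ : ℤ → FreeGroup (Fin n)} (hv : T.IsCoords v κ) (hw : T.IsCoords w ξ) :
    T.IsCoords (v * w) fun j => κ (j + algSum (Fin.last n) w) * ξ j where
  apply j t ht := by
    rw [map_mul, Homeomorph.mul_apply, hw.apply j t ht, hv.apply _ _ (T.init_eval_mem_dom ht _),
      map_mul, Homeomorph.mul_apply, algSum_mul]
    congr 2
    ring
  finite := by
    refine ((hv.finite.preimage
      (add_left_injective (algSum (Fin.last n) w)).injOn).union hw.finite).subset ?_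
    intro j hj
    by_contra hc
    simp only [mem_union, mem_preimage, mem_ofPred_eq, not_or, not_not] at hc
    exact hj (by simp [hc.1, hc.2])
  algSum_castSucc p := by
    simp only [algSum_mul, hv.algSum_castSucc, hw.algSum_castSucc]
    rw [finsum_add_distrib]
    · congr 1
      exact (finsum_comp_equiv (Equiv.addRight (algSum (Fin.last n) w))
        (f := fun j => algSum p (κ j))).symm
    · exact (finite_algSum hv.finite p).preimage
        (add_left_injective (algSum (Fin.last n) w)).injOn
    · exact finite_algSum hw.finite p

theorem exists_isCoords {n : ℕ} (T : Tower (n + 1)) (w : FreeGroup (Fin (n + 1))) :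
    ∃ κ, T.IsCoords w κ := by
  induction w using FreeGroup.induction_on with
  | C1 => exact ⟨_, T.isCoords_one⟩
  | of x =>
    induction x using Fin.lastCases with
    | last => exact ⟨_, T.isCoords_of_last⟩
    | cast q => exact ⟨_, T.isCoords_of_castSucc q⟩
  | inv_of x h => exact ⟨_, h.choose_spec.inv⟩
  | mul x y hx hy => exact ⟨_, hx.choose_spec.mul hy.choose_spec⟩

/-! ### Uniqueness of levels -/

/-- The identity does not shift tiles, so the top sum is zero; each coordinate then represents the
identity too, and lower sums are totals over coordinates. -/
theorem algSum_eq_zero_of_eval_eq_one {n : ℕ} (T : Tower n) {w : FreeGroup (Fin n)}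
    (h : T.eval w = 1) (p : Fin n) : algSum p w = 0 := by
  induction n with
  | zero => exact p.elim0
  | succ n ih =>
    obtain ⟨κ, hκ⟩ := T.exists_isCoords w
    have hlo : T.lo (Fin.last n) ∈ T.dom := ⟨le_rfl, T.topTranslation.lo_lt_hi⟩
    have key : ∀ j, ∀ t ∈ T.dom,
        (T.top ^ j) t = (T.top ^ (j + algSum (Fin.last n) w)) (T.init.eval (κ j) t) :=
      fun j t ht => by rw [← hκ.apply j t ht, h]; rfl
    have hm : algSum (Fin.last n) w = 0 := by
      have := T.topTranslation.zpow_apply_unique hlo (T.init_eval_mem_dom hlo _) (key 0 _ hlo)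
      omega
    induction p using Fin.lastCases with
    | last => exact hm
    | cast q =>
      rw [hκ.algSum_castSucc]
      refine finsum_eq_zero_of_forall_eq_zero fun j => ih T.init ?_ q
      refine Homeomorph.ext fun t => ?_
      by_cases ht : t ∈ T.dom
      · have := key j t ht
        rw [hm, add_zero] at this
        exact ((T.top ^ j).injective this).symm
      · exact T.init_eval_fix (fun h => ht (Ioo_subset_Ico_self h)) _

theorem algSum_eq_of_eval_eq {n : ℕ} (T : Tower n) {v w : FreeGroup (Fin n)}
    (h : T.eval v = T.eval w) (p : Fin n) : algSum p v = algSum p w := by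
  have := T.algSum_eq_zero_of_eval_eq_one (w := v * w⁻¹) (by rw [map_mul, map_inv, h]; simp) p
  rw [algSum_mul, algSum_inv] at this
  omega

theorem hasLevel_iff {n : ℕ} (T : Tower n) {w : FreeGroup (Fin n)} {p : Fin n}
    (hp : algSum p w ≠ 0) (h : ∀ q, p < q → algSum q w = 0) (m : ℕ) :
    HasLevel T.g (T.eval w) m ↔ m = p + 1 := by
  have key : ∀ v, T.eval v = T.eval w →
      IsGreatest {k : ℕ | ∃ q : Fin n, k = (q : ℕ) + 1 ∧ algSum q v ≠ 0} (p + 1) := by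
    intro v hv
    refine ⟨⟨p, rfl, by rwa [T.algSum_eq_of_eval_eq hv]⟩, ?_⟩
    rintro k ⟨q, rfl, hq⟩
    rw [T.algSum_eq_of_eval_eq hv] at hq
    by_contra! hc
    exact hq (h q (Fin.lt_def.2 (by omega)))
  constructor
  · rintro ⟨v, hv, hm⟩
    exact hm.unique (key v hv)
  · rintro rfl
    exact ⟨w, rfl, key w rfl⟩

end Tower

/-! ### Tools for commutation of conjugates -/

theorem commute_of_disjoint_supp {f g : HomeoI} (h : ∀ t, f t = t ∨ g t = t) : Commute f g := by
  have key : ∀ f g : HomeoI, (∀ t, f t = t ∨ g t = t) → ∀ t, f t = t → f (g t) = g (f t) := by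
    intro f g h t ht
    rcases h (g t) with h1 | h1
    · rw [h1, ht]
    · rw [g.injective h1, ht, g.injective h1]
  refine Homeomorph.ext fun t => ?_
  rw [Homeomorph.mul_apply, Homeomorph.mul_apply]
  rcases h t with h1 | h1
  · exact key f g h t h1
  · exact (key g f (fun t => (h t).symm) t h1).symm

/-- Allows the conjugator to be replaced by its coordinate on the tile supporting `g`. -/
theorem conj_eq_conj_of_eqOn {f f' g : HomeoI} {D : Set I} (h : ∀ x ∈ D, f x = f' x)
    (hg : ∀ x ∉ D, g x = x) : f * g * f⁻¹ = f' * g * f'⁻¹ := by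
  have hgD : ∀ x ∈ D, g x ∈ D := fun x hx => by
    by_contra hc
    exact hc (by rwa [g.injective (hg _ hc)])
  refine Homeomorph.ext fun t => ?_
  obtain ⟨x, rfl⟩ := f.surjective t
  rw [Homeomorph.mul_apply, Homeomorph.mul_apply, Homeomorph.mul_apply, Homeomorph.mul_apply,
    homeo_inv_apply_self]
  by_cases hx : x ∈ D
  · rw [h x hx, homeo_inv_apply_self, h _ (hgD x hx)]
  · rw [hg x hx, hg, homeo_apply_inv_self]
    intro hc
    have h1 := h _ hc
    rw [homeo_apply_inv_self] at h1
    exact hx (by rwa [← f.injective h1])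

theorem pow_eqOn {f f' : HomeoI} {D : Set I} (h : ∀ x ∈ D, f x = f' x)
    (hD : ∀ x ∈ D, f' x ∈ D) (k : ℕ) : ∀ x ∈ D, (f ^ k) x = (f' ^ k) x := by
  induction k with
  | zero => intro x _; rfl
  | succ k ih =>
    intro x hx
    rw [pow_succ, pow_succ, Homeomorph.mul_apply, Homeomorph.mul_apply, h x hx, ih _ (hD x hx)]

theorem commute_mul_mul_iff {G : Type*} [Group G] {a b r : G} (ha : Commute r a)
    (hb : Commute r b) : Commute (a * r) (b * r) ↔ Commute a b := by
  have h1 : a * r * (b * r) = a * b * (r * r) := by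
    rw [mul_assoc, ← mul_assoc r b, hb.eq]; simp only [mul_assoc]
  have h2 : b * r * (a * r) = b * a * (r * r) := by
    rw [mul_assoc, ← mul_assoc r a, ha.eq]; simp only [mul_assoc]
  rw [commute_iff_eq, commute_iff_eq, h1, h2, mul_left_inj]

theorem commute_conj_conj_iff {G : Type*} [Group G] (c a b : G) :
    Commute (c * a * c⁻¹) (c * b * c⁻¹) ↔ Commute a b := by
  rw [commute_iff_eq, commute_iff_eq]
  constructor
  · intro h
    have h' : c * (a * b) * c⁻¹ = c * (b * a) * c⁻¹ := by simpa [mul_assoc] using h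
    exact mul_left_cancel (mul_right_cancel h')
  · intro h
    have h' : c * (a * b) * c⁻¹ = c * (b * a) * c⁻¹ := by rw [h]
    simpa [mul_assoc] using h'

/-! ### Fixed points and triviality near an end -/

namespace Tower

theorem IsCoords.apply_zero {n : ℕ} {T : Tower (n + 1)} {w : FreeGroup (Fin (n + 1))}
    {κ : ℤ → FreeGroup (Fin n)} (h : T.IsCoords w κ) {t : I} (ht : t ∈ T.dom) :
    T.eval w t = (T.top ^ algSum (Fin.last n) w) (T.init.eval (κ 0) t) := by
  simpa using h.apply 0 t ht

theorem eval_mem_orb_last {n : ℕ} (T : Tower (n + 1)) {t : I} (ht : t ∈ T.orb (Fin.last n))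
    (w : FreeGroup (Fin (n + 1))) : T.eval w t ∈ T.orb (Fin.last n) := by
  have h1 := T.eval_mono w ht.1
  have h2 := T.eval_mono w ht.2
  rw [T.eval_fix_of_notMem (fun h => lt_irrefl _ h.1)] at h1
  rw [T.eval_fix_of_notMem (fun h => lt_irrefl _ h.2)] at h2
  exact ⟨h1, h2⟩

/-- A word shifts the tile index of every point of the top support by its top exponent sum. -/
theorem algSum_last_eq_zero_of_fixed {n : ℕ} (T : Tower (n + 1)) {w : FreeGroup (Fin (n + 1))}
    {t : I} (ht : t ∈ T.orb (Fin.last n)) (h : T.eval w t = t) : algSum (Fin.last n) w = 0 := by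
  obtain ⟨κ, hκ⟩ := T.exists_isCoords w
  obtain ⟨j, x, hx, rfl⟩ := T.topTranslation.exists_zpow_apply ht
  rw [hκ.apply j x hx] at h
  have := T.topTranslation.zpow_apply_unique (T.init_eval_mem_dom hx _) hx h
  omega

theorem fixed_near_end_of_algSum_last {n : ℕ} (T : Tower (n + 1)) {w : FreeGroup (Fin (n + 1))}
    (h : algSum (Fin.last n) w = 0) :
    ∃ e < T.b (Fin.last n), ∀ t ∈ Ioo e (T.b (Fin.last n)), T.eval w t = t := by
  obtain ⟨κ, hκ⟩ := T.exists_isCoords w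
  obtain ⟨J, hJ⟩ := hκ.finite.bddAbove
  have hlo : T.lo (Fin.last n) ∈ T.orb (Fin.last n) :=
    T.dom_subset ⟨le_rfl, T.topTranslation.lo_lt_hi⟩
  have he := T.topTranslation.zpow_apply_mem hlo (J + 1)
  -- The bound is the left end of tile `J + 1`, beyond all nontrivial coordinates.
  refine ⟨_, he.2, fun t ht => ?_⟩
  obtain ⟨j, x, hx, rfl⟩ := T.topTranslation.exists_zpow_apply ⟨he.1.trans ht.1, ht.2⟩
  have hj : κ j = 1 := by
    by_contra hc
    have h1 : j + 1 ≤ J + 1 := by linarith [hJ hc]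
    have h2 := T.topTranslation.zpow_lo_strictMono.monotone h1
    have h3 := T.topTranslation.zpow_mono j hx.2
    rw [T.topTranslation.zpow_hi] at h3
    exact lt_irrefl _ ((h3.trans_le h2).trans ht.1)
  rw [hκ.apply j x hx, hj, h, add_zero, map_one]
  rfl

/-- The fixed point forces the top exponent sum to vanish, so on `T.dom` the word acts as its
coordinate `0`. This descends until `p` is the last generator, where finiteness of the coordinates
applies. -/
theorem fixed_near_end {n : ℕ} (T : Tower n) {w : FreeGroup (Fin n)} {p : Fin n} {z : I}
    (hz : z ∈ T.orb p) (h : T.eval w z = z) :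
    ∃ e < T.b p, ∀ t ∈ Ioo e (T.b p), T.eval w t = t := by
  induction n with
  | zero => exact p.elim0
  | succ n ih =>
    induction p using Fin.lastCases with
    | last => exact T.fixed_near_end_of_algSum_last (T.algSum_last_eq_zero_of_fixed hz h)
    | cast q =>
      have hd : ∀ t ∈ T.init.orb q, t ∈ T.dom := fun t ht =>
        Ioo_subset_Ico_self (T.orb_init_subset q (Ioo_subset_Icc_self ht))
      obtain ⟨κ, hκ⟩ := T.exists_isCoords w
      have hm := T.algSum_last_eq_zero_of_fixed (T.dom_subset (hd z hz)) h
      have key : ∀ t ∈ T.dom, T.eval w t = T.init.eval (κ 0) t := fun t ht => by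
        rw [hκ.apply_zero ht, hm, zpow_zero]; rfl
      obtain ⟨e, he, h'⟩ := ih T.init (p := q) hz ((key z (hd z hz)).symm.trans h)
      refine ⟨max e (T.init.a q), max_lt he (T.translation q.castSucc |>.a_lt_lo.trans
        ((T.translation q.castSucc).lo_lt_hi.trans (T.translation q.castSucc).hi_lt_b)), ?_⟩
      intro t ht
      rw [key t (hd t ⟨(le_max_right _ _).trans_lt ht.1, ht.2⟩)]
      exact h' t ⟨(le_max_left _ _).trans_lt ht.1, ht.2⟩

/-! ### The commutation property of generators -/

/-- The quotient of the conjugate by `T.top` has top exponent sum zero, so it is trivial near the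
right end; since it commutes with `T.top`, it is trivial everywhere. -/
theorem conj_top_eq_of_commute {n : ℕ} (T : Tower (n + 1)) (c : FreeGroup (Fin (n + 1)))
    (h : Commute (T.eval c * T.top * (T.eval c)⁻¹) T.top) :
    T.eval c * T.top * (T.eval c)⁻¹ = T.top := by
  set v := c * FreeGroup.of (Fin.last n) * c⁻¹ * (FreeGroup.of (Fin.last n))⁻¹ with hv
  have hev : T.eval v = T.eval c * T.top * (T.eval c)⁻¹ * T.top⁻¹ := by
    simp only [hv, map_mul, map_inv, eval_of]; rfl
  have hsum : algSum (Fin.last n) v = 0 := by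
    rw [hv, algSum_mul, algSum_conj, algSum_inv, add_neg_cancel]
  obtain ⟨e, he, hfix⟩ := T.fixed_near_end_of_algSum_last hsum
  have hcomm : Commute T.top (T.eval v) := by
    rw [hev]
    exact h.symm.mul_right (Commute.refl _).inv_right
  have h1 := fixed_of_commute_of_fixed_near_end T.topTranslation.mono T.topTranslation.fix_b
    (fun t ht => (T.topTranslation.supp_iff t).2 ht) he hfix hcomm
  have h2 : T.eval v = 1 := Homeomorph.ext fun t => by
    by_cases ht : t ∈ T.orb (Fin.last n)
    · exact h1 t ht
    · exact T.eval_fix_of_notMem ht v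
  rwa [hev, mul_inv_eq_one] at h2

/-- For the last generator, eventual commutation forces the powers themselves to commute with it.
For a lower one, `v` either preserves the fundamental domain, where its coordinate `0` replaces it,
or moves that domain off itself and makes the supports disjoint. -/
theorem commute_conj_of_eventually {n : ℕ} (T : Tower n) (p : Fin n) (v : FreeGroup (Fin n))
    (h : ∃ K : ℕ, ∀ k ≥ K, Commute (T.eval v ^ k * T.g p * (T.eval v ^ k)⁻¹) (T.g p)) :
    Commute (T.eval v * T.g p * (T.eval v)⁻¹) (T.g p) := by
  induction n with
  | zero => exact p.elim0
  | succ n ih =>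
    obtain ⟨K, hK⟩ := h
    induction p using Fin.lastCases with
    | last =>
      have key : ∀ k ≥ K, Commute (T.eval v ^ k) T.top := fun k hk => by
        have h1 := T.conj_top_eq_of_commute (v ^ k) (by rw [map_pow]; exact hK k hk)
        rw [map_pow, mul_inv_eq_iff_eq_mul] at h1
        exact h1
      -- Two consecutive powers commute with `T.top`, hence so does their quotient.
      have h1 := (key (K + 1) (by omega)).mul_left (key K le_rfl).inv_left
      rw [pow_succ', mul_inv_cancel_right] at h1
      change Commute (T.eval v * T.top * _) T.top
      rw [h1.eq, mul_inv_cancel_right]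
    | cast q =>
      have hd : ∀ t, T.g q.castSucc t ≠ t → t ∈ T.dom := fun t ht =>
        Ioo_subset_Ico_self (T.orb_init_subset q (Ioo_subset_Icc_self
          (((T.translation q.castSucc).supp_iff t).1 ht)))
      obtain ⟨κ, hκ⟩ := T.exists_isCoords v
      by_cases hm : algSum (Fin.last n) v = 0
      · have key : ∀ t ∈ T.dom, T.eval v t = T.init.eval (κ 0) t := fun t ht => by
          rw [hκ.apply_zero ht, hm, zpow_zero]; rfl
        have hg : ∀ t ∉ T.dom, T.g q.castSucc t = t := fun t ht => not_not.1 fun hc => ht (hd t hc)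
        rw [conj_eq_conj_of_eqOn key hg]
        refine ih T.init q (κ 0) ⟨K, fun k hk => ?_⟩
        have := hK k hk
        rwa [conj_eq_conj_of_eqOn (pow_eqOn key (fun t ht => T.init_eval_mem_dom ht _) k) hg]
          at this
      · refine commute_of_disjoint_supp fun t => ?_
        by_contra! hc
        obtain ⟨x, rfl⟩ := (T.eval v).surjective t
        have hx : x ∈ T.dom := hd x fun hx => hc.1 (by
          rw [Homeomorph.mul_apply, Homeomorph.mul_apply, homeo_inv_apply_self, hx])
        have h1 := hd _ hc.2
        refine hm (T.topTranslation.zpow_apply_unique (T.init_eval_mem_dom hx (κ 0)) h1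
          (j := 0) ?_)
        rw [← hκ.apply_zero hx]
        rfl

/-! ### Failure of the property for mixed levels -/

/-- Pulled back by `c₁`, `w` has no fixed point on the support of generator `p`; pulled back by
`c₂`, it fixes `x`, hence all points near the right end. Commutation would make the second pullback
trivial there, contrary to `y`. -/
theorem not_commute_conj {n : ℕ} (T : Tower n) {p : Fin n} {w c₁ c₂ : FreeGroup (Fin n)}
    (hmoved : ∀ t ∈ T.orb p, T.eval w (T.eval c₁ t) ≠ T.eval c₁ t)
    (hend : T.eval w (T.eval c₁ (T.b p)) = T.eval c₁ (T.b p))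
    {x y : I} (hx : x ∈ T.orb p) (hy : y ∈ T.orb p)
    (hfx : T.eval w (T.eval c₂ x) = T.eval c₂ x) (hmy : T.eval w (T.eval c₂ y) ≠ T.eval c₂ y) :
    ¬ Commute (T.eval (c₂ * c₁⁻¹) * T.eval w * (T.eval (c₂ * c₁⁻¹))⁻¹) (T.eval w) := by
  intro hc
  have hiff : ∀ c t, T.eval (c⁻¹ * w * c) t = t ↔ T.eval w (T.eval c t) = T.eval c t :=
    fun c t => by
      rw [map_mul, map_mul, map_inv, Homeomorph.mul_apply, Homeomorph.mul_apply,
        homeo_inv_apply_eq_iff]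
  have hc' : Commute (T.eval (c₁⁻¹ * w * c₁)) (T.eval (c₂⁻¹ * w * c₂)) := by
    rw [← commute_conj_conj_iff (T.eval c₂)]
    convert hc using 1
    · simp [mul_assoc]
    · simp [mul_assoc]
  obtain ⟨e, he, hfix⟩ := T.fixed_near_end hx ((hiff c₂ x).2 hfx)
  exact hmy ((hiff c₂ y).1 (fixed_of_commute_of_fixed_near_end (T.eval_mono _)
    ((hiff c₁ _).2 hend) (fun t ht h => hmoved t ht ((hiff c₁ t).1 h)) he hfix hc' y hy))

theorem exists_coord_ne_one {n : ℕ} {T : Tower (n + 1)} {w : FreeGroup (Fin (n + 1))}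
    {κ : ℤ → FreeGroup (Fin n)} (h : T.IsCoords w κ) (hm : algSum (Fin.last n) w = 0) {t : I}
    (ht : T.eval w t ≠ t) : ∃ j, ∃ x ∈ T.dom, (T.top ^ j) x = t ∧ κ j ≠ 1 := by
  have h1 : t ∈ T.orb (Fin.last n) := by
    by_contra hc
    exact ht (T.eval_fix_of_notMem hc w)
  obtain ⟨j, x, hx, rfl⟩ := T.topTranslation.exists_zpow_apply h1
  refine ⟨j, x, hx, rfl, fun hj => ht ?_⟩
  rw [h.apply j x hx, hm, hj, map_one, add_zero]
  rfl

theorem eventually_commute_conj {n : ℕ} (T : Tower (n + 1)) {w τ : FreeGroup (Fin (n + 1))}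
    (hw : algSum (Fin.last n) w = 0) (hτ : algSum (Fin.last n) τ ≠ 0) :
    ∃ K : ℕ, ∀ k ≥ K, Commute (T.eval τ ^ k * T.eval w * (T.eval τ ^ k)⁻¹) (T.eval w) := by
  obtain ⟨κ, hκ⟩ := T.exists_isCoords w
  obtain ⟨M, hM⟩ := hκ.finite.bddAbove
  obtain ⟨N, hN⟩ := hκ.finite.bddBelow
  -- The nontrivial coordinates of `w` lie in `[N, M]`; a shift by more than `M - N` tiles separates
  -- them.
  refine ⟨(M - N).toNat + 1, fun k hk => commute_of_disjoint_supp fun t => ?_⟩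
  by_contra! hc
  obtain ⟨s, rfl⟩ := (T.eval τ ^ k : HomeoI).surjective t
  have hs : T.eval w s ≠ s := fun hs => hc.1 (by
    rw [Homeomorph.mul_apply, Homeomorph.mul_apply, homeo_inv_apply_self, hs])
  obtain ⟨i, x, hx, rfl, hi⟩ := exists_coord_ne_one hκ hw hs
  obtain ⟨j, y, hy, hyt, hj⟩ := exists_coord_ne_one hκ hw hc.2
  obtain ⟨ξ, hξ⟩ := T.exists_isCoords (τ ^ k)
  rw [← map_pow, hξ.apply i x hx] at hyt
  have h1 := T.topTranslation.zpow_apply_unique hy (T.init_eval_mem_dom hx _) hyt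
  have h2 : algSum (Fin.last n) (τ ^ k) = k * algSum (Fin.last n) τ := by
    simp [algSum]
  have hiM := hM hi
  have hiN := hN hi
  have hjM := hM hj
  have hjN := hN hj
  have h3 : (k : ℤ) > M - N := by omega
  have h4 : |algSum (Fin.last n) (τ ^ k)| ≤ M - N := by
    rw [abs_le]; omega
  rw [h2, abs_mul, Nat.abs_cast] at h4
  have h5 := Int.one_le_abs hτ
  nlinarith

theorem commute_conj_iff_of_eqOn {n : ℕ} (T : Tower (n + 1)) {h : HomeoI}
    {k : FreeGroup (Fin n)} (hk : ∀ t ∈ T.dom, h t = T.init.eval k t) (v : FreeGroup (Fin n)) :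
    Commute (T.init.eval v * h * (T.init.eval v)⁻¹) h ↔
      Commute (T.init.eval v * T.init.eval k * (T.init.eval v)⁻¹) (T.init.eval k) := by
  set r := (T.init.eval k)⁻¹ * h with hr
  have hrd : ∀ t ∈ T.dom, r t = t := fun t ht => by
    rw [hr, Homeomorph.mul_apply, hk t ht, homeo_inv_apply_self]
  -- `r` carries the action of `h` outside the domain, where all lower words are trivial.
  have hrc : ∀ u, Commute r (T.init.eval u) := fun u => commute_of_disjoint_supp fun t => by
    by_cases ht : t ∈ T.dom
    · exact Or.inl (hrd t ht)
    · exact Or.inr (T.init_eval_fix (fun h => ht (Ioo_subset_Ico_self h)) u)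
  have hh : h = T.init.eval k * r := by rw [hr, mul_inv_cancel_left]
  have h2 : T.init.eval v * h * (T.init.eval v)⁻¹ =
      T.init.eval v * T.init.eval k * (T.init.eval v)⁻¹ * r := by
    rw [hh, ← mul_assoc, mul_assoc _ r, mul_assoc _ _ r, (hrc v).inv_right.eq]
  rw [h2, hh]
  refine commute_mul_mul_iff ?_ (hrc k)
  rw [← map_inv, ← map_mul, ← map_mul]
  exact hrc _

/-- If `c₁` and `c₂` use different tiles, `τ = c₂ * c₁⁻¹` works: its powers eventually separate the
supports, yet it matches the two incompatible pullbacks. If both use tile `m`, the witness for the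
coordinate `κ m` is conjugated into that tile by `T.top ^ m`. -/
theorem exists_eventually_commute_not_commute {n : ℕ} (T : Tower n) {p : Fin n}
    {w c₁ c₂ : FreeGroup (Fin n)}
    (hmoved : ∀ t ∈ T.orb p, T.eval w (T.eval c₁ t) ≠ T.eval c₁ t)
    (hend : T.eval w (T.eval c₁ (T.b p)) = T.eval c₁ (T.b p))
    {x y : I} (hx : x ∈ T.orb p) (hy : y ∈ T.orb p)
    (hfx : T.eval w (T.eval c₂ x) = T.eval c₂ x) (hmy : T.eval w (T.eval c₂ y) ≠ T.eval c₂ y) :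
    ∃ τ, (∃ K : ℕ, ∀ k ≥ K, Commute (T.eval τ ^ k * T.eval w * (T.eval τ ^ k)⁻¹) (T.eval w)) ∧
      ¬ Commute (T.eval τ * T.eval w * (T.eval τ)⁻¹) (T.eval w) := by
  induction n with
  | zero => exact p.elim0
  | succ n ih =>
    induction p using Fin.lastCases with
    | last =>
      exfalso
      -- All words preserve the top support, so the fixed point seen through `c₂` is also seen
      -- through `c₁`.
      refine hmoved (T.eval (c₁⁻¹ * c₂) x) (T.eval_mem_orb_last hx _) ?_
      rw [map_mul, map_inv, Homeomorph.mul_apply, homeo_apply_inv_self, hfx]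
    | cast q =>
      have hd : ∀ t ∈ T.init.orb q, t ∈ T.dom := fun t ht =>
        Ioo_subset_Ico_self (T.orb_init_subset q (Ioo_subset_Icc_self ht))
      have hw : algSum (Fin.last n) w = 0 := T.algSum_last_eq_zero_of_fixed
        (T.eval_mem_orb_last (T.dom_subset (hd x hx)) c₂) hfx
      by_cases hm : algSum (Fin.last n) c₁ = algSum (Fin.last n) c₂
      · obtain ⟨κ, hκ⟩ := T.exists_isCoords w
        obtain ⟨ξ₁, hξ₁⟩ := T.exists_isCoords c₁
        obtain ⟨ξ₂, hξ₂⟩ := T.exists_isCoords c₂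
        set m := algSum (Fin.last n) c₂ with hmdef
        have hbd : T.init.b q ∈ T.dom := Ioo_subset_Ico_self (T.orb_init_subset q
          ⟨((T.translation q.castSucc).a_lt_lo.trans ((T.translation q.castSucc).lo_lt_hi.trans
            (T.translation q.castSucc).hi_lt_b)).le, le_rfl⟩)
        have key : ∀ {c ξ}, T.IsCoords c ξ → algSum (Fin.last n) c = m → ∀ t ∈ T.dom,
            (T.eval w (T.eval c t) = T.eval c t ↔
              T.init.eval (κ m) (T.init.eval (ξ 0) t) = T.init.eval (ξ 0) t) := by
          intro c ξ hξ hcm t ht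
          rw [hξ.apply_zero ht, hcm, hκ.apply _ _ (T.init_eval_mem_dom ht _), hw, add_zero]
          exact (T.top ^ m).injective.eq_iff
        obtain ⟨τ, ⟨K, hK⟩, hτ⟩ := ih T.init (p := q) (w := κ m) (c₁ := ξ₁ 0) (c₂ := ξ₂ 0)
          (fun t ht h => hmoved t ht ((key hξ₁ hm t (hd t ht)).2 h))
          ((key hξ₁ hm _ hbd).1 hend) hx hy ((key hξ₂ rfl x (hd x hx)).1 hfx)
          (fun h => hmy ((key hξ₂ rfl y (hd y hy)).2 h))
        have hagree : ∀ t ∈ T.dom, ((T.top ^ m)⁻¹ * T.eval w * T.top ^ m : HomeoI) t =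
            T.init.eval (κ m) t := fun t ht => by
          rw [Homeomorph.mul_apply, Homeomorph.mul_apply, homeo_inv_apply_eq_iff,
            hκ.apply m t ht, hw, add_zero]
        have hconj : ∀ k : ℕ, Commute
            ((T.top ^ m * T.init.eval τ * (T.top ^ m)⁻¹) ^ k * T.eval w *
              ((T.top ^ m * T.init.eval τ * (T.top ^ m)⁻¹) ^ k)⁻¹) (T.eval w) ↔
            Commute (T.init.eval τ ^ k * T.init.eval (κ m) * (T.init.eval τ ^ k)⁻¹)
              (T.init.eval (κ m)) := by
          intro k
          have h1 := T.commute_conj_iff_of_eqOn hagree (τ ^ k)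
          rw [map_pow] at h1
          rw [← h1, ← commute_conj_conj_iff (T.top ^ m)⁻¹, conj_pow]
          simp only [mul_assoc, inv_inv, mul_inv_rev, inv_mul_cancel_left, inv_mul_cancel, mul_one]
        have hev : T.eval (FreeGroup.of (Fin.last n) ^ m * FreeGroup.map Fin.castSucc τ *
            (FreeGroup.of (Fin.last n) ^ m)⁻¹) =
            T.top ^ m * T.init.eval τ * (T.top ^ m)⁻¹ := by
          rw [map_mul, map_mul, map_inv, map_zpow, eval_of, eval_map_castSucc]
          rfl
        refine ⟨FreeGroup.of (Fin.last n) ^ m * FreeGroup.map Fin.castSucc τ *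
            (FreeGroup.of (Fin.last n) ^ m)⁻¹, ⟨K, fun k hk => ?_⟩, fun hc => hτ ?_⟩
        · rw [hev, hconj]
          exact hK k hk
        · rw [hev] at hc
          simpa using (hconj 1).1 (by simpa using hc)
      · refine ⟨c₂ * c₁⁻¹, T.eventually_commute_conj hw ?_,
          T.not_commute_conj hmoved hend hx hy hfx hmy⟩
        rw [algSum_mul, algSum_inv]
        omega

/-! ### Orbitals, bumps and their levels -/

theorem a_lt_b {n : ℕ} (T : Tower n) (p : Fin n) : T.a p < T.b p :=
  (T.translation p).a_lt_lo.trans ((T.translation p).lo_lt_hi.trans (T.translation p).hi_lt_b)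

/-- Every orbital of an element of the group generated by a tower is a translate of the support of
some generator, and the bump on it is a conjugate of an element whose level is that of the
generator. -/
theorem exists_bump {n : ℕ} (T : Tower n) (w : FreeGroup (Fin n)) {A : Set I}
    (hA : IsOrbital (T.eval w) A) :
    ∃ p c v, A = T.eval c '' T.orb p ∧ IsBumpOn (T.eval w) A (T.eval (c * v * c⁻¹)) ∧
      algSum p v ≠ 0 ∧ (∀ q, p < q → algSum q v = 0) ∧
      T.eval w (T.eval c (T.b p)) = T.eval c (T.b p) := by
  induction n generalizing A with
  | zero =>
    obtain ⟨t, ht⟩ := hA.prop.1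
    exact absurd (T.eval_fix (fun p => p.elim0) w) (hA.prop.2.2 ht)
  | succ n ih =>
    obtain ⟨κ, hκ⟩ := T.exists_isCoords w
    have hAorb : A ⊆ T.orb (Fin.last n) := fun t ht => by
      by_contra hc
      exact hA.prop.2.2 ht (T.eval_fix_of_notMem hc w)
    by_cases hm : algSum (Fin.last n) w = 0
    · obtain ⟨t, htA⟩ := hA.prop.1
      obtain ⟨j, x, hx, rfl⟩ := T.topTranslation.exists_zpow_apply (hAorb htA)
      have hj : ∀ y ∈ T.dom, T.eval w ((T.top ^ j) y) = (T.top ^ j) (T.init.eval (κ j) y) :=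
        fun y hy => by rw [hκ.apply j y hy, hm, add_zero]
      -- With zero top sum all tile endpoints are fixed, so the orbital lies inside a single tile.
      have hfix : ∀ i : ℤ, (T.top ^ i) (T.lo (Fin.last n)) ∉ A := fun i hi => by
        refine hA.prop.2.2 hi ?_
        rw [hκ.apply i _ ⟨le_rfl, T.topTranslation.lo_lt_hi⟩, hm, add_zero,
          T.init_eval_fix (fun h => lt_irrefl _ h.1)]
      have hAsub : ∀ y, (T.top ^ j) y ∈ A →
          y ∈ Ioo (T.lo (Fin.last n)) (T.hi (Fin.last n)) := by
        intro y hy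
        have hmono := T.topTranslation.zpow_mono j
        constructor
        · by_contra! hc
          exact hfix j (hA.prop.2.1.out hy htA ⟨hmono.monotone hc, hmono.monotone hx.1⟩)
        · by_contra! hc
          refine hfix (j + 1) (hA.prop.2.1.out htA hy ?_)
          rw [← T.topTranslation.zpow_hi]
          exact ⟨(hmono hx.2).le, hmono.monotone hc⟩
      have hmono := T.topTranslation.zpow_mono j
      have hA0 : IsOrbital (T.init.eval (κ j)) ((T.top ^ j) ⁻¹' A) := by
        refine ⟨⟨⟨x, htA⟩, ?_, ?_⟩, ?_⟩
        · exact ⟨fun y hy z hz u hu =>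
            hA.prop.2.1.out hy hz ⟨hmono.monotone hu.1, hmono.monotone hu.2⟩⟩
        · intro y hy hc
          refine hA.prop.2.2 hy ?_
          rw [hj y (Ioo_subset_Ico_self (hAsub y hy)), hc]
        · rintro B ⟨hB, hBo, hBs⟩ hAB
          have hBd : ∀ y ∈ B, y ∈ Ioo (T.lo (Fin.last n)) (T.hi (Fin.last n)) := fun y hy => by
            by_contra hc
            exact hBs hy (T.init_eval_fix hc _)
          have hle : A ⊆ (T.top ^ j) '' B := fun s hs =>
            ⟨(T.top ^ j)⁻¹ s, hAB (by rwa [mem_preimage, homeo_apply_inv_self]),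
              homeo_apply_inv_self _ _⟩
          have hBA : (T.top ^ j) '' B ⊆ A := by
            refine hA.le_of_ge ⟨hB.image _, ⟨?_⟩, ?_⟩ hle
            · rintro _ ⟨y, hy, rfl⟩ _ ⟨z, hz, rfl⟩ u hu
              obtain ⟨u, rfl⟩ := (T.top ^ j).surjective u
              exact ⟨u, hBo.out hy hz ⟨hmono.le_iff_le.1 hu.1, hmono.le_iff_le.1 hu.2⟩, rfl⟩
            · rintro _ ⟨y, hy, rfl⟩ hc
              rw [hj y (Ioo_subset_Ico_self (hBd y hy))] at hc
              exact hBs hy ((T.top ^ j).injective hc)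
          exact fun y hy => hBA ⟨y, hy, rfl⟩
      obtain ⟨p, c, v, hAc, ⟨-, hb1, hb2⟩, hv1, hv2, hend⟩ := ih T.init (κ j) hA0
      set L := FreeGroup.of (Fin.last n) ^ j with hL
      have hLe : T.eval L = T.top ^ j := by rw [hL, map_zpow, eval_of]; rfl
      have hconj : T.eval (L * FreeGroup.map Fin.castSucc c * FreeGroup.map Fin.castSucc v *
          (L * FreeGroup.map Fin.castSucc c)⁻¹) =
          T.top ^ j * T.init.eval (c * v * c⁻¹) * (T.top ^ j)⁻¹ := by
        simp only [map_mul, map_inv, eval_map_castSucc, hLe, mul_inv_rev, mul_assoc]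
      have hbd : T.init.b p ∈ Ioo (T.lo (Fin.last n)) (T.hi (Fin.last n)) :=
        T.orb_init_subset p ⟨(T.init.a_lt_b p).le, le_rfl⟩
      refine ⟨p.castSucc, L * FreeGroup.map Fin.castSucc c, FreeGroup.map Fin.castSucc v,
        ?_, ⟨hA, ?_, ?_⟩, ?_, ?_, ?_⟩
      · rw [map_mul, eval_map_castSucc, hLe]
        ext s
        obtain ⟨y, rfl⟩ := (T.top ^ j).surjective s
        change y ∈ (T.top ^ j) ⁻¹' A ↔ _
        rw [hAc]
        constructor
        · rintro ⟨z, hz, rfl⟩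
          exact ⟨z, hz, rfl⟩
        · rintro ⟨z, hz, h⟩
          exact ⟨z, hz, (T.top ^ j).injective h⟩
      · intro s hs
        obtain ⟨y, rfl⟩ := (T.top ^ j).surjective s
        rw [hconj, Homeomorph.mul_apply, Homeomorph.mul_apply, homeo_inv_apply_self, hb1 y hs,
          hj y (Ioo_subset_Ico_self (hAsub y hs))]
      · intro s hs
        obtain ⟨y, rfl⟩ := (T.top ^ j).surjective s
        rw [hconj, Homeomorph.mul_apply, Homeomorph.mul_apply, homeo_inv_apply_self, hb2 y hs]
      · rwa [algSum_map_castSucc]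
      · intro q hq
        induction q using Fin.lastCases with
        | last => exact algSum_last_map_castSucc v
        | cast q =>
          rw [algSum_map_castSucc]
          exact hv2 q (Fin.castSucc_lt_castSucc_iff.1 hq)
      · rw [map_mul, eval_map_castSucc, hLe, Homeomorph.mul_apply]
        have h1 := T.init_eval_mem_Ioo hbd c
        change T.eval w ((T.top ^ j) (T.init.eval c (T.init.b p))) =
          (T.top ^ j) (T.init.eval c (T.init.b p))
        rw [hj _ (Ioo_subset_Ico_self h1), hend]
    -- With nonzero top sum no point of the top support is fixed, so it is the only orbital.
    · have horb : T.orb (Fin.last n) ⊆ supp (T.eval w) := fun t ht hc =>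
        hm (T.algSum_last_eq_zero_of_fixed ht hc)
      have hAeq : A = T.orb (Fin.last n) :=
        hA.eq_of_subset ⟨⟨_, T.dom_subset ⟨le_rfl, T.topTranslation.lo_lt_hi⟩⟩,
          ordConnected_Ioo, horb⟩ hAorb
      refine ⟨Fin.last n, 1, w, ?_, ⟨hA, ?_, ?_⟩, hm, fun q hq => ?_, ?_⟩
      · rw [map_one, hAeq]
        exact (image_id _).symm
      · simp
      · intro t ht
        rw [inv_one, one_mul, mul_one]
        exact T.eval_fix_of_notMem (hAeq ▸ ht) w
      · exact absurd hq (Fin.le_last q).not_gt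
      · exact T.eval_fix_of_notMem (fun h => lt_irrefl _ h.2) w

/-- If the element `h` has the property that `t * h * t⁻¹` commutes with `h` as soon as
`t ^ k * h * (t ^ k)⁻¹` does for all large `k`, then any two orbitals of `h` have the same level. -/
theorem levels_le_of_commute {n : ℕ} (T : Tower n) {w : FreeGroup (Fin n)}
    (hw : ∀ τ, (∃ K : ℕ, ∀ k ≥ K,
        Commute (T.eval τ ^ k * T.eval w * (T.eval τ ^ k)⁻¹) (T.eval w)) →
      Commute (T.eval τ * T.eval w * (T.eval τ)⁻¹) (T.eval w))
    {p q : Fin n} {c d : FreeGroup (Fin n)}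
    (hc : IsOrbital (T.eval w) (T.eval c '' T.orb p))
    (hd : IsOrbital (T.eval w) (T.eval d '' T.orb q))
    (hcb : T.eval w (T.eval c (T.b p)) = T.eval c (T.b p))
    (hdb : T.eval w (T.eval d (T.b q)) = T.eval d (T.b q)) : p ≤ q := by
  by_contra! hqp
  have h1 := T.nested q p hqp
  -- If `q < p`, the translate by `d` of the larger support contains the fixed endpoint of the
  -- smaller orbital and also moved points.
  have hb : T.b q ∈ T.orb p := ⟨(T.translation p).a_lt_lo.trans (h1.1.trans (T.a_lt_b q)),
    h1.2.trans (T.translation p).hi_lt_b⟩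
  obtain ⟨y, hy⟩ := exists_between (T.a_lt_b q)
  have hyp : y ∈ T.orb p :=
    ⟨(T.translation p).a_lt_lo.trans (h1.1.trans hy.1), hy.2.trans hb.2⟩
  obtain ⟨τ, h2, h3⟩ := T.exists_eventually_commute_not_commute (p := p) (w := w) (c₁ := c)
    (c₂ := d) (fun t ht => hc.prop.2.2 ⟨t, ht, rfl⟩) hcb hb hyp hdb (hd.prop.2.2 ⟨y, hy, rfl⟩)
  exact h3 (hw τ h2)

theorem eval_mem_closure {n : ℕ} (T : Tower n) (w : FreeGroup (Fin n)) :
    T.eval w ∈ Subgroup.closure (Set.range T.g) := by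
  rw [← FreeGroup.range_lift_eq_closure]
  exact ⟨w, rfl⟩

theorem exists_eval_eq {n : ℕ} (T : Tower n) {h : HomeoI}
    (hh : h ∈ Subgroup.closure (Set.range T.g)) : ∃ w, T.eval w = h := by
  rwa [← FreeGroup.range_lift_eq_closure] at hh

theorem exists_level {n : ℕ} (T : Tower n) {h : HomeoI}
    (hh : h ∈ Subgroup.closure (Set.range T.g))
    (hcomm : ∀ t ∈ Subgroup.closure (Set.range T.g),
      (∃ K : ℕ, ∀ k ≥ K, Commute (t ^ k * h * (t ^ k)⁻¹) h) → Commute (t * h * t⁻¹) h) :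
    ∃ l : ℕ, ∀ A, IsOrbital h A → ∃ b ∈ Subgroup.closure (Set.range T.g),
      IsBumpOn h A b ∧ ∀ m, HasLevel T.g b m ↔ m = l := by
  obtain ⟨w, rfl⟩ := T.exists_eval_eq hh
  have hw := fun τ => hcomm (T.eval τ) (T.eval_mem_closure τ)
  by_cases hex : ∃ A, IsOrbital (T.eval w) A
  · obtain ⟨A₀, hA₀⟩ := hex
    obtain ⟨p, c, v, rfl, -, -, -, hcb⟩ := T.exists_bump w hA₀
    refine ⟨p + 1, fun A hA => ?_⟩
    obtain ⟨q, d, u, rfl, hbump, hu1, hu2, hdb⟩ := T.exists_bump w hA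
    obtain rfl : p = q := le_antisymm (T.levels_le_of_commute hw hA₀ hA hcb hdb)
      (T.levels_le_of_commute hw hA hA₀ hdb hcb)
    refine ⟨_, T.eval_mem_closure _, hbump, fun m => T.hasLevel_iff ?_ ?_ m⟩
    · rwa [algSum_conj]
    · intro q hq
      rw [algSum_conj]
      exact hu2 q hq
  -- Without orbitals, any value of the level will do.
  · exact ⟨0, fun A hA => (hex ⟨A, hA⟩).elim⟩

end Tower

/-! ### Disjointness of the deleted intervals -/

/-- The closed intervals that occur at the `k`-th stage of the Cantor-type construction. -/
inductive IsStage : ℕ → ℝ → ℝ → Prop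
  | unit : IsStage 0 0 1
  | left {k : ℕ} {a b : ℝ} : IsStage k a b → IsStage (k + 1) a (a + (b - a) / 4)
  | right {k : ℕ} {a b : ℝ} : IsStage k a b → IsStage (k + 1) (b - (b - a) / 4) b

theorem IsStageInterval.exists_isStage {a b : ℝ} (h : IsStageInterval a b) : ∃ k, IsStage k a b := by
  induction h with
  | unit => exact ⟨0, .unit⟩
  | left _ ih => exact ⟨_, ih.choose_spec.left⟩
  | right _ ih => exact ⟨_, ih.choose_spec.right⟩

theorem IsStage.lt {k : ℕ} {a b : ℝ} (h : IsStage k a b) : a < b := by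
  induction h with
  | unit => norm_num
  | left _ ih => linarith
  | right _ ih => linarith

theorem IsStage.eq_or_disjoint {k : ℕ} {a b c d : ℝ} (h : IsStage k a b) (h' : IsStage k c d) :
    (a = c ∧ b = d) ∨ b < c ∨ d < a := by
  induction h generalizing c d with
  | unit => cases h'; simp
  | @left k a b h ih =>
    have := h.lt
    cases h' with
    | left h' =>
      have := h'.lt
      rcases ih h' with ⟨rfl, rfl⟩ | h1 | h1
      · simp
      · exact Or.inr (Or.inl (by linarith))
      · exact Or.inr (Or.inr (by linarith))
    | right h' =>
      have := h'.lt
      rcases ih h' with ⟨rfl, rfl⟩ | h1 | h1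
      · exact Or.inr (Or.inl (by linarith))
      · exact Or.inr (Or.inl (by linarith))
      · exact Or.inr (Or.inr (by linarith))
  | @right k a b h ih =>
    have := h.lt
    cases h' with
    | left h' =>
      have := h'.lt
      rcases ih h' with ⟨rfl, rfl⟩ | h1 | h1
      · exact Or.inr (Or.inr (by linarith))
      · exact Or.inr (Or.inl (by linarith))
      · exact Or.inr (Or.inr (by linarith))
    | right h' =>
      have := h'.lt
      rcases ih h' with ⟨rfl, rfl⟩ | h1 | h1
      · simp
      · exact Or.inr (Or.inl (by linarith))
      · exact Or.inr (Or.inr (by linarith))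

/-- Every interval of a later stage is contained in one of each earlier stage. -/
theorem IsStage.exists_ancestor {k l : ℕ} {a b : ℝ} (h : IsStage k a b) (hl : l ≤ k) :
    ∃ c d, IsStage l c d ∧ c ≤ a ∧ b ≤ d := by
  induction h with
  | unit => obtain rfl : l = 0 := by omega
            exact ⟨0, 1, .unit, le_rfl, le_rfl⟩
  | @left k a b h ih =>
    have := h.lt
    rcases hl.eq_or_lt with rfl | hl
    · exact ⟨_, _, h.left, le_rfl, le_rfl⟩
    · obtain ⟨c, d, h1, h2, h3⟩ := ih (by omega)
      exact ⟨c, d, h1, h2, by linarith⟩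
  | @right k a b h ih =>
    have := h.lt
    rcases hl.eq_or_lt with rfl | hl
    · exact ⟨_, _, h.right, le_rfl, le_rfl⟩
    · obtain ⟨c, d, h1, h2, h3⟩ := ih (by omega)
      exact ⟨c, d, h1, by linarith, h3⟩

theorem IsDeletedInterval.lt {l r : ℝ} (h : IsDeletedInterval l r) : l < r := by
  obtain ⟨a, b, hs, rfl, rfl⟩ := h
  have := hs.exists_isStage.choose_spec.lt
  linarith

/-- Deleted intervals are equal or disjoint. -/
theorem IsDeletedInterval.eq_or_disjoint {l r l' r' : ℝ} (h : IsDeletedInterval l r)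
    (h' : IsDeletedInterval l' r') : (l = l' ∧ r = r') ∨ r ≤ l' ∨ r' ≤ l := by
  obtain ⟨a, b, hs, rfl, rfl⟩ := h
  obtain ⟨a', b', hs', rfl, rfl⟩ := h'
  obtain ⟨k, hk⟩ := hs.exists_isStage
  obtain ⟨k', hk'⟩ := hs'.exists_isStage
  -- The stage `k + 1` ancestor of the later interval is one of the two children of `[a, b]` or lies
  -- outside `[a, b]`, so it misses the deleted middle.
  have key : ∀ {k k' : ℕ} {a b a' b' : ℝ}, IsStage k a b → IsStage k' a' b' → k < k' →
      b - (b - a) / 4 ≤ a' + (b' - a') / 4 ∨ b' - (b' - a') / 4 ≤ a + (b - a) / 4 := by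
    intro k k' a b a' b' hk hk' hlt
    have h0 := hk.lt
    have h0' := hk'.lt
    obtain ⟨c, d, hcd, h1, h2⟩ := hk'.exists_ancestor (l := k + 1) (by omega)
    rcases hcd.eq_or_disjoint hk.left with ⟨rfl, rfl⟩ | h3 | h3
    · right; linarith
    · right; linarith
    · rcases hcd.eq_or_disjoint hk.right with ⟨rfl, rfl⟩ | h4 | h4
      · left; linarith
      · exfalso
        cases hcd with
        | left h5 =>
          have := h5.lt
          rcases h5.eq_or_disjoint hk with ⟨rfl, rfl⟩ | h6 | h6 <;> linarith
        | right h5 =>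
          have := h5.lt
          rcases h5.eq_or_disjoint hk with ⟨rfl, rfl⟩ | h6 | h6 <;> linarith
      · left; linarith
  rcases lt_trichotomy k k' with h | rfl | h
  · exact Or.inr (key hk hk' h)
  · have := hk.lt
    have := hk'.lt
    rcases hk.eq_or_disjoint hk' with ⟨rfl, rfl⟩ | h | h
    · simp
    · exact Or.inr (Or.inl (by linarith))
    · exact Or.inr (Or.inr (by linarith))
  · exact Or.inr (key hk' hk h).symm

/-! ### The generators form a tower -/

namespace Construction

variable {C : Type*} [LinearOrder C]

/-- The midpoint of the deleted interval attached to `c`. -/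
noncomputable def mid (W : Construction C) (c : C) : ℝ := (W.left c + W.right c) / 2

theorem bounds (W : Construction C) (c : C) :
    3 / 4 ≤ W.left c ∧ W.left c < W.mid c ∧ W.mid c < W.right c ∧ W.right c ≤ 1 := by
  have h := (W.deleted c).lt
  have h1 : Icc (W.left c) (W.right c) ⊆ Icc (3 / 4) 1 := by
    rw [← closure_Ioo h.ne]
    exact closure_minimal (W.confined c) isClosed_Icc
  rw [Icc_subset_Icc_iff h.le] at h1
  refine ⟨h1.1, ?_, ?_, h1.2⟩ <;> rw [mid] <;> linarith

/-- Distinct deleted intervals are disjoint. This places the closed support of each generator inside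
the fundamental domain of every later one. -/
theorem mid_lt_left (W : Construction C) {c d : C} (h : c < d) : W.mid c < W.left d := by
  have hm : W.mid c < W.mid d := W.strictMono_mid h
  have hc := W.bounds c
  have hd := W.bounds d
  rcases (W.deleted c).eq_or_disjoint (W.deleted d) with ⟨h1, h2⟩ | h1 | h1
  · rw [mid, mid, h1, h2] at hm
    exact (lt_irrefl _ hm).elim
  · linarith
  · linarith

theorem isTranslation (W : Construction C) (c : C) : IsTranslation (W.f c)
    ⟨1 - W.mid c, by have := W.bounds c; constructor <;> linarith⟩
    ⟨1 - W.left c, by have := W.bounds c; constructor <;> linarith⟩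
    ⟨W.left c, by have := W.bounds c; constructor <;> linarith⟩
    ⟨W.mid c, by have := W.bounds c; constructor <;> linarith⟩ where
  mono := (W.mem_F c).1
  supp_iff t := W.supp_eq c t
  map_lo := Subtype.ext (W.map_left c _ rfl)
  lo_lt_hi := by have := W.bounds c; exact Subtype.mk_lt_mk.2 (by linarith)
  a_lt_lo := by have := W.bounds c; exact Subtype.mk_lt_mk.2 (by linarith)
  hi_lt_b := by have := W.bounds c; exact Subtype.mk_lt_mk.2 (by linarith)

/-- The tower attached to a finite set of indices. -/
noncomputable def tower (W : Construction C) (X : Finset C) : Tower X.card where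
  g := W.gen X
  a _ := _
  lo _ := _
  hi _ := _
  b _ := _
  translation p := W.isTranslation (X.orderEmbOfFin rfl p)
  nested p q h := by
    have h1 := W.mid_lt_left ((X.orderEmbOfFin rfl).strictMono h)
    exact ⟨Subtype.mk_lt_mk.2 (by linarith), Subtype.mk_lt_mk.2 h1⟩

theorem exists_gen_eq (W : Construction C) {X Y : Finset C} (h : X ⊆ Y) (p : Fin X.card) :
    ∃ q, W.gen Y q = W.gen X p := by
  have h1 : X.orderEmbOfFin rfl p ∈ Set.range (Y.orderEmbOfFin rfl) := by
    rw [Finset.range_orderEmbOfFin]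
    exact h (Finset.orderEmbOfFin_mem X rfl p)
  obtain ⟨q, hq⟩ := h1
  exact ⟨q, congrArg W.f hq⟩

end Construction

/-! ### Transfer of the property along the homomorphisms -/

/-- If `d : G → H`, `u : H → G'` and `d' : G' → H'` are homomorphisms such that `u ∘ d` and
`d' ∘ u` are inclusions, then all bumps of the image under `d` of a generator of `G` have the same
level. -/
theorem exists_level_of_homs {C D : Type*} [LinearOrder C] [LinearOrder D] (W : Construction C)
    (V : Construction D) {X X' : Finset C} {Y Y' : Finset D} (hX : X ⊆ X')
    (d : W.subgroup X →* V.subgroup Y) (u : V.subgroup Y →* W.subgroup X')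
    (d' : W.subgroup X' →* V.subgroup Y') (hu : ∀ g, (u (d g) : HomeoI) = g)
    (hd : ∀ h, (d' (u h) : HomeoI) = h) (p : Fin X.card) :
    ∃ l : ℕ, ∀ A, IsOrbital (d (W.genMem X p) : HomeoI) A → ∃ b ∈ V.subgroup Y,
      IsBumpOn (d (W.genMem X p) : HomeoI) A b ∧ ∀ m, HasLevel (V.gen Y) b m ↔ m = l := by
  refine (V.tower Y).exists_level (d (W.genMem X p)).2 ?_
  rintro t ht ⟨K, hK⟩
  obtain ⟨q, hq⟩ := W.exists_gen_eq hX p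
  set h := d (W.genMem X p) with hh
  let t' : V.subgroup Y := ⟨t, ht⟩
  -- The generator keeps its identity in the larger tower, though its index may change.
  have hg : (u h : HomeoI) = W.gen X' q := by rw [hq]; exact hu _
  obtain ⟨v, hv⟩ := (W.tower X').exists_eval_eq (u t').2
  have h1 : ∀ k ≥ K, Commute (t' ^ k * h * (t' ^ k)⁻¹) h := fun k hk => Subtype.ext (hK k hk)
  have h2 := (W.tower X').commute_conj_of_eventually q v ⟨K, fun k hk => by
    have h3 := ((h1 k hk).map u).map (W.subgroup X').subtype
    simp only [map_mul, map_inv, map_pow, Subgroup.subtype_apply, hg] at h3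
    rw [hv]
    exact h3⟩
  rw [hv] at h2
  have h4 : Commute (u (t' * h * t'⁻¹)) (u h) := Subtype.ext (by
    simp only [map_mul, map_inv, Subgroup.coe_mul, Subgroup.coe_inv, hg]
    exact h2)
  have h5 := (h4.map d').map (V.subgroup Y').subtype
  simp only [Subgroup.subtype_apply, hd] at h5
  exact h5

end WC

theorem mainTheorem10 {C D : Type*} [LinearOrder C] [Countable C] [LinearOrder D] [Countable D]
    (W : WC.Construction C) (V : WC.Construction D)
    (X : ℕ → Finset C) (hX : WC.IsExhaustion X)
    (Y : ℕ → Finset D) (hY : WC.IsExhaustion Y)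
    (P : WC.InjIso (fun i => W.subgroup (X i)) (fun i => V.subgroup (Y i))) :
    (∀ (i : ℕ) (p : Fin (X i).card), ∃ l : ℕ,
      ∀ A : Set unitInterval, WC.IsOrbital (P.d i (W.genMem (X i) p) : WC.HomeoI) A →
        ∃ b ∈ V.subgroup (Y i),
          WC.IsBumpOn (P.d i (W.genMem (X i) p) : WC.HomeoI) A b ∧
          ∀ m : ℕ, WC.HasLevel (V.gen (Y i)) b m ↔ m = l) ∧
    (∀ (i : ℕ) (p : Fin (Y i).card), ∃ l : ℕ,
      ∀ A : Set unitInterval, WC.IsOrbital (P.u i (V.genMem (Y i) p) : WC.HomeoI) A →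
        ∃ b ∈ W.subgroup (X (i + 1)),
          WC.IsBumpOn (P.u i (V.genMem (Y i) p) : WC.HomeoI) A b ∧
          ∀ m : ℕ, WC.HasLevel (W.gen (X (i + 1))) b m ↔ m = l) :=
  ⟨fun i p => WC.exists_level_of_homs W V (hX.mono i.le_succ) (P.d i) (P.u i) (P.d (i + 1))
      (P.u_d i) (P.d_u i) p,
    fun i p => WC.exists_level_of_homs V W (hY.mono i.le_succ) (P.u i) (P.d (i + 1))
      (P.u (i + 1)) (P.d_u i) (P.u_d (i + 1)) p⟩
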